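/- Let $P$ be a finite set of points (sites) in $\mathbb{R}^2$. A circle of positive radius is called empty if the open disc that it bounds contains no point of $P$, and it is a maximal empty circle (MEC) if it is empty and its open disc is not contained in that of any other empty circle. A Voronoi edge of $P$ is a set with more than one point of the form $\{x : |x-p| = |x-q| \le |x-s| \text{ for all } s\in P\}$ with $p\ne q$ in $P$. Let $C$ and $C'$ be two distinct MECs with centers $c$ and $c'$, identified with their open discs, that overlap within the convex hull of $P$, i.e. $C\cap C'\cap \operatorname{conv}(P)\neq\emptyset$. Then there is exactly one simple path from $c$ to $c'$ along the Voronoi edges (that is, exactly one set that is the image of an injective continuous path from $c$ to $c'$ contained in the union of the Voronoi edges) such that every MEC centered on the path encloses $C\cap C'$, i.e. its open disc contains $C\cap C'$. -/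

import Mathlib

/-- The Euclidean plane. -/
abbrev Plane : Type := EuclideanSpace ℝ (Fin 2)

/-- The circle with centre `c` and radius `r > 0` is empty for the sites `P` if no site lies in
the open disc bounded by it (sites may lie on the circle itself). -/
def IsEmptyCircle (P : Finset Plane) (c : Plane) (r : ℝ) : Prop :=
  0 < r ∧ ∀ p ∈ P, p ∉ Metric.ball c r

/-- A maximal empty circle (MEC): an empty circle that is not contained in any other
empty circle. -/
def IsMEC (P : Finset Plane) (c : Plane) (r : ℝ) : Prop :=
  IsEmptyCircle P c r ∧
    ∀ (d : Plane) (s : ℝ), IsEmptyCircle P d s → Metric.ball c r ⊆ Metric.ball d s →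
      d = c ∧ s = r

/-- The closed Voronoi cell of the site `p`: the points that have `p` as a nearest site. -/
def voronoiCell (P : Finset Plane) (p : Plane) : Set Plane :=
  {x | ∀ q ∈ P, dist x p ≤ dist x q}

/-- A Voronoi edge: the common part of the closed cells of two distinct sites, when it has more
than one point. It is a closed segment, a closed half-line or a line. -/
def IsVoronoiEdge (P : Finset Plane) (e : Set Plane) : Prop :=
  ∃ p ∈ P, ∃ q ∈ P, p ≠ q ∧ e = voronoiCell P p ∩ voronoiCell P q ∧ e.Nontrivial

/-- The union of all Voronoi edges. -/
def voronoiSkeleton (P : Finset Plane) : Set Plane :=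
  ⋃₀ {e | IsVoronoiEdge P e}

/-- `A` is (the trace of) a simple path from `c` to `c'` along the Voronoi edges of `P`. -/
def IsVoronoiPath (P : Finset Plane) (c c' : Plane) (A : Set Plane) : Prop :=
  ∃ γ : Path c c', Function.Injective γ ∧ Set.range γ = A ∧ A ⊆ voronoiSkeleton P

/-! Centres of MECs are exactly the points with two nearest sites (`isMEC_of_two_sites`,
`IsMEC.exists_two_sites`), and the radius is the distance to those sites. With `S = C ∩ C'`, an MEC
encloses `S` exactly when its centre lies in `domRegion P S`, an intersection of half-planes and
hence convex. So the claim is that `c` and `c'` are joined by exactly one arc in `T = multiCells P ∩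
domRegion P S`.

Existence (`arcJoined_multiCells`): push each point of the segment from `c` to `c'` away from its
nearest site until a second site is equally near. A point of `S` in the convex hull guarantees that
this happens at finite distance. The push preserves `domRegion`, is continuous and fixes
`multiCells`, so it carries the segment to a connected subset of `T`, which is locally joined by
segments.

Uniqueness (`mem_of_isPreconnected`): the rays from a point `x` of `T` through its nearest sites
avoid `T`. Two such rays bound a sector around each branch of `T` at `x`, and near `x` that sector
contains no other branch. An arc through `x` leaves the sector there, so any connected subset of `T`
with the same end points must also pass through `x`. -/

open scoped RealInnerProductSpace

/-! ### Concatenation of arcs. -/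

/-- `a` and `b` coincide or are joined by an arc inside `S`. -/
def ArcJoined {X : Type*} [TopologicalSpace X] (S : Set X) (a b : X) : Prop :=
  ∃ (f : ℝ → X) (u v : ℝ), u ≤ v ∧ Continuous f ∧ Set.InjOn f (Set.Icc u v) ∧
    Set.MapsTo f (Set.Icc u v) S ∧ f u = a ∧ f v = b

namespace ArcJoined

variable {X : Type*} [TopologicalSpace X] {S : Set X} {a b d : X}

theorem symm (h : ArcJoined S a b) : ArcJoined S b a := by
  obtain ⟨f, u, v, huv, hf, hinj, hmap, rfl, rfl⟩ := h
  refine ⟨fun t => f (-t), -v, -u, by linarith, by fun_prop, ?_, ?_, by simp, by simp⟩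
  · intro s hs t ht hst
    have := hinj (x₁ := -s) ⟨by linarith [hs.2], by linarith [hs.1]⟩
      (x₂ := -t) ⟨by linarith [ht.2], by linarith [ht.1]⟩ hst
    linarith
  · intro s hs
    exact hmap ⟨by linarith [hs.2], by linarith [hs.1]⟩

/-- Plain concatenation may lose injectivity. The first arc is therefore cut at the first parameter
`t` at which it meets the second, say at parameter `s` there, and continued along the second from
`s`. -/
theorem trans [T2Space X] (h₁ : ArcJoined S a b) (h₂ : ArcJoined S b d) : ArcJoined S a d := by
  obtain ⟨f, u, v, huv, hf, hinj, hmap, rfl, rfl⟩ := h₁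
  obtain ⟨g, u', v', huv', hg, hginj, hgmap, hgu, rfl⟩ := h₂
  have hcomp : IsCompact (Set.Icc u v ∩ f ⁻¹' (g '' Set.Icc u' v')) :=
    isCompact_Icc.inter_right ((isCompact_Icc.image hg).isClosed.preimage hf)
  obtain ⟨t, ⟨htI, s, hsI, hst⟩, hleast⟩ :=
    hcomp.exists_isLeast ⟨v, ⟨huv, le_rfl⟩, u', ⟨le_rfl, huv'⟩, hgu⟩
  have hdisj : ∀ τ ∈ Set.Icc u v, ∀ σ ∈ Set.Icc u' v', f τ = g σ → t ≤ τ :=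
    fun τ hτ σ hσ h => hleast ⟨hτ, σ, hσ, h.symm⟩
  refine ⟨fun τ => if τ ≤ t then f τ else g (s + τ - t), u, t + v' - s, by linarith [hsI.2, htI.1],
    ?_, ?_, ?_, by simp [htI.1], ?_⟩
  · refine Continuous.if_le hf (by fun_prop) continuous_id continuous_const ?_
    rintro τ rfl
    simp [hst]
  · intro x hx y hy hxy
    by_cases hxt : x ≤ t <;> by_cases hyt : y ≤ t <;> simp only [hxt, hyt, if_true, if_false] at hxy
    · exact hinj ⟨hx.1, hxt.trans htI.2⟩ ⟨hy.1, hyt.trans htI.2⟩ hxy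
    · have hyI : s + y - t ∈ Set.Icc u' v' :=
        ⟨by linarith [hsI.1], by linarith [hy.2]⟩
      have hx' := hdisj x ⟨hx.1, hxt.trans htI.2⟩ _ hyI hxy
      obtain rfl : x = t := le_antisymm hxt hx'
      have := hginj hsI hyI (hst.trans hxy)
      linarith
    · have hxI : s + x - t ∈ Set.Icc u' v' :=
        ⟨by linarith [hsI.1], by linarith [hx.2]⟩
      have hy' := hdisj y ⟨hy.1, hyt.trans htI.2⟩ _ hxI hxy.symm
      obtain rfl : y = t := le_antisymm hyt hy'
      have := hginj hsI hxI (hst.trans hxy.symm)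
      linarith
    · have := hginj (x₁ := s + x - t) ⟨by linarith [hsI.1], by linarith [hx.2]⟩
        (x₂ := s + y - t) ⟨by linarith [hsI.1], by linarith [hy.2]⟩ hxy
      linarith
  · intro x hx
    by_cases hxt : x ≤ t
    · simpa [hxt] using hmap ⟨hx.1, hxt.trans htI.2⟩
    · simpa [hxt] using hgmap (x := s + x - t) ⟨by linarith [hsI.1], by linarith [hx.2]⟩
  -- This case occurs only when the arcs meet at the very end of the second one, of which nothing is
  -- then left to append.
  · by_cases h : t + v' - s ≤ t
    · have hsv : s = v' := le_antisymm hsI.2 (by linarith)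
      subst hsv
      simp [hst]
    · simp [h]

theorem of_segment_subset {E : Type*} [NormedAddCommGroup E] [NormedSpace ℝ E] {S : Set E} {a b : E}
    (h : segment ℝ a b ⊆ S) : ArcJoined S a b := by
  by_cases hab : a = b
  · subst hab
    refine ⟨fun _ => a, 0, 0, le_rfl, continuous_const, ?_, ?_, rfl, rfl⟩
    · simp
    · intro _ _
      exact h (left_mem_segment ℝ a a)
  · refine ⟨AffineMap.lineMap a b, 0, 1, zero_le_one, AffineMap.lineMap_continuous, ?_, ?_,
      by simp, by simp⟩
    · exact (AffineMap.lineMap_injective ℝ hab).injOn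
    · intro t ht
      exact h (by rw [segment_eq_image_lineMap]; exact ⟨t, ht, rfl⟩)

/-- Distinct points joined by an arc are joined by an injective path. -/
theorem exists_path (h : ArcJoined S a b) (hab : a ≠ b) :
    ∃ γ : Path a b, Function.Injective γ ∧ Set.range γ ⊆ S := by
  obtain ⟨f, u, v, huv, hf, hinj, hmap, rfl, rfl⟩ := h
  have huv' : 0 < v - u := by
    rcases huv.lt_or_eq with h | h
    · linarith
    · exact absurd (by rw [h]) hab
  have hI : ∀ t : unitInterval, u + t * (v - u) ∈ Set.Icc u v := fun t =>
    ⟨by nlinarith [t.2.1], by nlinarith [t.2.2]⟩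
  refine ⟨⟨⟨fun t => f (u + t * (v - u)), by fun_prop⟩, by simp, by simp⟩, ?_, ?_⟩
  · intro s t hst
    have := hinj (hI s) (hI t) hst
    exact Subtype.ext (mul_right_cancel₀ huv'.ne' (by linarith))
  · rintro _ ⟨t, rfl⟩
    exact hmap (hI t)

end ArcJoined

/-! ### Bisectors and half-spaces. -/

section Cells

variable {E : Type*} [NormedAddCommGroup E] [InnerProductSpace ℝ E]

theorem dist_sq_sub_dist_sq (x p q : E) :
    dist x q ^ 2 - dist x p ^ 2 = ‖q - p‖ ^ 2 - 2 * ⟪x - p, q - p⟫ := by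
  have h : x - q = (x - p) - (q - p) := by abel
  rw [dist_eq_norm, dist_eq_norm, h, norm_sub_sq_real]
  ring

theorem dist_le_dist_iff_inner (x p q : E) :
    dist x p ≤ dist x q ↔ 2 * ⟪x - p, q - p⟫ ≤ ‖q - p‖ ^ 2 := by
  rw [← sq_le_sq₀ dist_nonneg dist_nonneg]
  have := dist_sq_sub_dist_sq x p q
  constructor <;> intro h <;> linarith

theorem dist_lt_dist_iff_inner (x p q : E) :
    dist x p < dist x q ↔ 2 * ⟪x - p, q - p⟫ < ‖q - p‖ ^ 2 := by
  rw [← sq_lt_sq₀ dist_nonneg dist_nonneg]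
  have := dist_sq_sub_dist_sq x p q
  constructor <;> intro h <;> linarith

theorem convex_setOf_dist_le (p q : E) : Convex ℝ {x : E | dist x p ≤ dist x q} := by
  intro x hx y hy a b ha hb hab
  simp only [Set.mem_ofPred_eq, dist_le_dist_iff_inner] at *
  have : a • x + b • y - p = a • (x - p) + b • (y - p) := by
    have : p = (a + b) • p := by rw [hab, one_smul]
    nth_rw 1 [this]
    module
  rw [this, inner_add_left, real_inner_smul_left, real_inner_smul_left]
  have hb' : b = 1 - a := by linarith
  subst hb'
  nlinarith

theorem convex_setOf_dist_lt (p q : E) : Convex ℝ {x : E | dist x p < dist x q} := by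
  intro x hx y hy a b ha hb hab
  simp only [Set.mem_ofPred_eq, dist_lt_dist_iff_inner] at *
  have : a • x + b • y - p = a • (x - p) + b • (y - p) := by
    have : p = (a + b) • p := by rw [hab, one_smul]
    nth_rw 1 [this]
    module
  rw [this, inner_add_left, real_inner_smul_left, real_inner_smul_left]
  have hb' : b = 1 - a := by linarith
  subst hb'
  rcases ha.eq_or_lt with rfl | ha
  · linarith
  · nlinarith

/-- A point with two nearest points `p ≠ q` sees them in different directions: the inner products
with a nonzero vector cannot both attain the Cauchy–Schwarz bound. -/
theorem inner_lt_of_two_points {n m w : E} (hnm : n ≠ m) (hnorm : ‖n‖ = ‖m‖) (hw : w ≠ 0)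
    (hin : ⟪n, w⟫ = ⟪m, w⟫) : ⟪n, w⟫ < ‖n‖ * ‖w‖ := by
  refine lt_of_le_of_ne (real_inner_le_norm n w) fun h => hnm ?_
  have h1 := inner_eq_norm_mul_iff_real.1 h
  have h2 := inner_eq_norm_mul_iff_real.1 (hin ▸ hnorm ▸ h : ⟪m, w⟫ = ‖m‖ * ‖w‖)
  rw [hnorm, ← h2] at h1
  exact smul_right_injective E (norm_ne_zero_iff.2 hw) h1

end Cells

/-! ### Maximal empty circles and points with two nearest sites. -/

section Sites

variable (P : Finset Plane)

theorem convex_voronoiCell (p : Plane) : Convex ℝ (voronoiCell P p) := by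
  have : voronoiCell P p = ⋂ q ∈ P, {x | dist x p ≤ dist x q} := by
    ext; simp [voronoiCell]
  rw [this]
  exact convex_iInter₂ fun q _ => convex_setOf_dist_le p q

theorem isClosed_voronoiCell (p : Plane) : IsClosed (voronoiCell P p) := by
  have : voronoiCell P p = ⋂ q ∈ P, {x | dist x p ≤ dist x q} := by
    ext; simp [voronoiCell]
  rw [this]
  exact isClosed_biInter fun q _ => isClosed_le (by fun_prop) (by fun_prop)

/-- The points that have at least two nearest sites. -/
def multiCells : Set Plane :=
  {x | ∃ p ∈ P, ∃ q ∈ P, p ≠ q ∧ x ∈ voronoiCell P p ∧ x ∈ voronoiCell P q}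

/-- The points that are closer to every point of `S` than to any site. -/
def domRegion (S : Set Plane) : Set Plane :=
  {x | ∀ y ∈ S, ∀ p ∈ P, dist x y < dist x p}

theorem convex_domRegion (S : Set Plane) : Convex ℝ (domRegion P S) := by
  have : domRegion P S = ⋂ y ∈ S, ⋂ p ∈ P, {x | dist x y < dist x p} := by
    ext; simp [domRegion]
  rw [this]
  exact convex_iInter₂ fun y _ => convex_iInter₂ fun p _ => convex_setOf_dist_lt y p

variable {P}

theorem dist_eq_of_mem_voronoiCell {p q x : Plane} (hp : p ∈ P) (hq : q ∈ P)
    (h1 : x ∈ voronoiCell P p) (h2 : x ∈ voronoiCell P q) : dist x p = dist x q :=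
  le_antisymm (h1 q hq) (h2 p hp)

theorem exists_mem_voronoiCell (hP : P.Nonempty) (x : Plane) : ∃ p ∈ P, x ∈ voronoiCell P p :=
  P.exists_min_image (dist x) hP

theorem notMem_domRegion {S : Set Plane} (hS : S.Nonempty) {p : Plane} (hp : p ∈ P) :
    p ∉ domRegion P S := by
  obtain ⟨y, hy⟩ := hS
  intro h
  have := h y hy p hp
  rw [dist_self] at this
  exact absurd this (not_lt.2 dist_nonneg)

theorem voronoiSkeleton_subset_multiCells : voronoiSkeleton P ⊆ multiCells P := by
  rintro x ⟨e, ⟨p, hp, q, hq, hpq, rfl, -⟩, hx⟩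
  exact ⟨p, hp, q, hq, hpq, hx.1, hx.2⟩

/-- The nearest sites of a point near `x` are among the nearest sites of `x`. -/
theorem eventually_mem_voronoiCell (P : Finset Plane) (x : Plane) :
    ∀ᶠ z in nhds x, ∀ p ∈ P, z ∈ voronoiCell P p → x ∈ voronoiCell P p := by
  rw [Finset.eventually_all]
  intro p _
  by_cases hx : x ∈ voronoiCell P p
  · exact Filter.Eventually.of_forall fun _ _ => hx
  · filter_upwards [(isClosed_voronoiCell P p).isOpen_compl.mem_nhds hx] with z hz hz'
    exact absurd hz' hz

theorem pos_of_two_sites {p q x : Plane} (hpq : p ≠ q) (h : dist x p = dist x q) :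
    0 < dist x p := by
  refine lt_of_le_of_ne dist_nonneg fun h0 => hpq ?_
  exact (dist_eq_zero.1 h0.symm).symm.trans (dist_eq_zero.1 (h ▸ h0.symm))

/-- The point of the closed inner ball farthest from `d` lies on the ray from `d` through `x`,
beyond `x`. -/
theorem add_dist_le_of_ball_subset_ball {E : Type*} [NormedAddCommGroup E] [NormedSpace ℝ E]
    {x d : E} {r s : ℝ} (hr : 0 < r) (hs : 0 < s) (hxd : x ≠ d)
    (h : Metric.ball x r ⊆ Metric.ball d s) : r + dist x d ≤ s := by
  have hn : 0 < ‖x - d‖ := norm_pos_iff.2 (sub_ne_zero.2 hxd)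
  have hcl : Metric.closedBall x r ⊆ Metric.closedBall d s := by
    rw [← closure_ball x hr.ne', ← closure_ball d hs.ne']
    exact closure_mono h
  have hmem : x + (r / ‖x - d‖) • (x - d) ∈ Metric.closedBall x r := by
    rw [Metric.mem_closedBall, dist_eq_norm, add_sub_cancel_left, norm_smul, Real.norm_eq_abs,
      abs_of_pos (by positivity), div_mul_cancel₀ _ hn.ne']
  have h2 := hcl hmem
  have : x + (r / ‖x - d‖) • (x - d) - d = (1 + r / ‖x - d‖) • (x - d) := by module
  rw [Metric.mem_closedBall, dist_eq_norm, this, norm_smul, Real.norm_eq_abs,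
      abs_of_pos (by positivity), add_mul, div_mul_cancel₀ _ hn.ne'] at h2
  rw [dist_eq_norm]
  linarith

theorem isMEC_of_two_sites {p q x : Plane} (hp : p ∈ P) (hq : q ∈ P) (hpq : p ≠ q)
    (hxp : x ∈ voronoiCell P p) (hxq : x ∈ voronoiCell P q) : IsMEC P x (dist x p) := by
  have heq := dist_eq_of_mem_voronoiCell hp hq hxp hxq
  have hpos := pos_of_two_sites hpq heq
  refine ⟨⟨hpos, fun z hz hmem => ?_⟩, fun d s hds hsub => ?_⟩
  · rw [Metric.mem_ball, dist_comm] at hmem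
    exact absurd (hxp z hz) (not_le.2 hmem)
  · have hdist : ∀ z ∈ P, s ≤ dist z d := fun z hz => by
      simpa using hds.2 z hz
    have hdx : d = x := by
      by_contra hne
      have h1 := add_dist_le_of_ball_subset_ball hpos hds.1 (Ne.symm hne) hsub
      -- A larger empty disc centred at `d` forces equality in the triangle inequality for `d`, `x`
      -- and each nearest site `z`, so `z - x` points along `x - d`. Two distinct sites equidistant
      -- from `x` cannot both do so.
      have key : ∀ z ∈ P, dist x z = dist x p → ⟪z - x, x - d⟫ = ‖z - x‖ * ‖x - d‖ := by
        intro z hz hzp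
        refine le_antisymm (real_inner_le_norm _ _) ?_
        have h2 := hdist z hz
        have h3 : dist x p + dist x d ≤ dist z d := h1.trans h2
        have e : z - d = (z - x) + (x - d) := by abel
        have e2 : dist z d ^ 2 = ‖z - x‖ ^ 2 + 2 * ⟪z - x, x - d⟫ + ‖x - d‖ ^ 2 := by
          rw [dist_eq_norm, e, norm_add_sq_real]
        rw [← hzp, dist_comm x z, dist_eq_norm z x, dist_eq_norm x d] at h3
        nlinarith [norm_nonneg (z - x), norm_nonneg (x - d)]
      have hp' := key p hp rfl
      have hq' := key q hq heq.symm
      have hnorm : ‖p - x‖ = ‖q - x‖ := by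
        rw [← dist_eq_norm, ← dist_eq_norm, dist_comm p, dist_comm q, heq]
      refine (inner_lt_of_two_points (fun h => hpq (sub_left_injective h)) hnorm
        (sub_ne_zero.2 (Ne.symm hne)) (by rw [hp', hq', hnorm])).ne hp'
    subst hdx
    refine ⟨rfl, le_antisymm ?_ ?_⟩
    · rw [dist_comm]; exact hdist p hp
    · by_contra! hlt
      have hcl : Metric.closedBall d (dist d p) ⊆ Metric.closedBall d s := by
        rw [← closure_ball d hpos.ne', ← closure_ball d hds.1.ne']
        exact closure_mono hsub
      have := hcl (show p ∈ _ by rw [Metric.mem_closedBall, dist_comm])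
      rw [Metric.mem_closedBall, dist_comm] at this
      linarith

/-- The centre of an MEC has two nearest sites, and the radius is their distance. -/
theorem IsMEC.exists_two_sites (hP : P.Nonempty) {x : Plane} {s : ℝ} (h : IsMEC P x s) :
    ∃ p ∈ P, ∃ q ∈ P, p ≠ q ∧ x ∈ voronoiCell P p ∧ x ∈ voronoiCell P q ∧ s = dist x p := by
  obtain ⟨p, hp, hxp⟩ := exists_mem_voronoiCell hP x
  have hle : s ≤ dist x p := by
    have := h.1.2 p hp
    rw [Metric.mem_ball, dist_comm] at this
    exact not_lt.1 this
  have hpos : 0 < dist x p := h.1.1.trans_le hle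
  have hs : s = dist x p := by
    refine (h.2 x (dist x p) ⟨hpos, fun z hz hmem => ?_⟩ (Metric.ball_subset_ball hle)).2.symm
    rw [Metric.mem_ball, dist_comm] at hmem
    exact absurd (hxp z hz) (not_le.2 hmem)
  by_contra! hcon
  have hfar : ∀ q ∈ P, q ≠ p → dist x p < dist x q := by
    intro q hq hqp
    refine lt_of_le_of_ne (hxp q hq) fun heq => ?_
    exact hcon p hp q hq (Ne.symm hqp) hxp (fun z hz => heq ▸ hxp z hz) hs
  -- With a single nearest site `p`, the centre can move away from `p` by `ε * dist x p`. The radius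
  -- grows by this amount while the other sites come nearer by at most as much, hence the factor
  -- `2`. The resulting larger empty disc contradicts maximality.
  have hev : ∀ᶠ ε in nhdsWithin (0 : ℝ) (Set.Ioi 0), ∀ q ∈ P, q ≠ p →
      2 * ε * dist x p < dist x q - dist x p := by
    rw [Finset.eventually_all]
    intro q hq
    by_cases hqp : q = p
    · simp [hqp]
    · have hc : Filter.Tendsto (fun ε : ℝ => 2 * ε * dist x p) (nhdsWithin (0 : ℝ) (Set.Ioi 0))
          (nhds (2 * 0 * dist x p)) :=
        (Continuous.tendsto (by fun_prop) 0).mono_left nhdsWithin_le_nhds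
      filter_upwards [hc.eventually_lt_const (u := dist x q - dist x p)
        (by linarith [hfar q hq hqp])] with ε hε _
      exact hε
  obtain ⟨ε, hε, hε0⟩ := (hev.and self_mem_nhdsWithin).exists
  have hε0 : 0 < ε := hε0
  set d : Plane := x + ε • (x - p) with hd
  have hxd : dist d x = ε * dist x p := by
    rw [hd, dist_eq_norm, add_sub_cancel_left, norm_smul, Real.norm_eq_abs, abs_of_pos hε0,
      dist_eq_norm]
  have hdp : dist d p = dist x p + ε * dist x p := by
    have : d - p = (1 + ε) • (x - p) := by rw [hd]; module
    rw [dist_eq_norm, this, norm_smul, Real.norm_eq_abs, abs_of_pos (by linarith), dist_eq_norm]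
    ring
  have hem : IsEmptyCircle P d (dist d p) := by
    refine ⟨by rw [hdp]; positivity, fun q hq hmem => ?_⟩
    rw [Metric.mem_ball, dist_comm] at hmem
    by_cases hqp : q = p
    · subst hqp; exact lt_irrefl _ hmem
    · have h1 := hε q hq hqp
      have h2 := dist_triangle x d q
      rw [dist_comm x d] at h2
      linarith
  have hsub : Metric.ball x s ⊆ Metric.ball d (dist d p) := by
    refine Metric.ball_subset_ball' ?_
    rw [dist_comm x d, hxd, hdp, hs]
  have := (h.2 d _ hem hsub).1
  rw [this, dist_self] at hxd
  exact (mul_pos hε0 hpos).ne hxd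

end Sites

/-! ### Existence: radial retraction onto the points with two nearest sites. -/

section Retraction

variable {P : Finset Plane}

/-- The reciprocal of the factor by which `x` has to be moved away from `p` to reach the boundary
of the Voronoi cell of `p`. -/
noncomputable def radialFactor (hP : P.Nonempty) (p x : Plane) : ℝ :=
  P.sup' hP fun q => 2 * ⟪x - p, q - p⟫ / ‖q - p‖ ^ 2

/-- The radial projection from `p` to the boundary of the Voronoi cell of `p`. -/
noncomputable def radialProj (hP : P.Nonempty) (p x : Plane) : Plane :=
  p + (radialFactor hP p x)⁻¹ • (x - p)

theorem continuous_radialFactor (hP : P.Nonempty) (p : Plane) :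
    Continuous (radialFactor hP p) := by
  refine Continuous.finset_sup'_apply hP fun q _ => ?_
  fun_prop

/-- Otherwise every site, and with them `y`, lies in the half-plane through `p` on the side away
from `x`, which makes `y` at least as far from `x` as `p` is. This is where the overlap inside the
convex hull enters. -/
theorem radialFactor_pos (hP : P.Nonempty) {p x y : Plane}
    (hy : y ∈ convexHull ℝ (P : Set Plane)) (hxy : dist x y < dist x p) :
    0 < radialFactor hP p x := by
  by_contra! h
  have hle : ∀ q ∈ P, ⟪x - p, q⟫ ≤ ⟪x - p, p⟫ := by
    intro q hq
    by_cases hqp : q = p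
    · rw [hqp]
    · have h1 := (Finset.le_sup' (fun q => 2 * ⟪x - p, q - p⟫ / ‖q - p‖ ^ 2) hq).trans h
      have hn : 0 < ‖q - p‖ ^ 2 := pow_pos (norm_pos_iff.2 (sub_ne_zero.2 hqp)) 2
      rw [div_le_iff₀ hn, zero_mul, inner_sub_right] at h1
      linarith
  have hconv : Convex ℝ {z : Plane | ⟪x - p, z⟫ ≤ ⟪x - p, p⟫} :=
    convex_halfSpace_le (innerₗ Plane (x - p)).isLinear _
  have hy' : ⟪x - p, y⟫ ≤ ⟪x - p, p⟫ := convexHull_min (fun q hq => hle q hq) hconv hy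
  have hd := dist_sq_sub_dist_sq x p y
  have hlt : dist x y ^ 2 < dist x p ^ 2 := by gcongr
  rw [inner_sub_right] at hd
  nlinarith [sq_nonneg ‖y - p‖]

theorem radialFactor_le_one (hP : P.Nonempty) {p x : Plane} (hx : x ∈ voronoiCell P p) :
    radialFactor hP p x ≤ 1 := by
  refine Finset.sup'_le hP _ fun q hq => div_le_one_of_le₀ ?_ (by positivity)
  exact (dist_le_dist_iff_inner x p q).1 (hx q hq)

theorem radialProj_eq_self (hP : P.Nonempty) {p q x : Plane} (hp : p ∈ P) (hq : q ∈ P)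
    (hpq : p ≠ q) (hxp : x ∈ voronoiCell P p) (hxq : x ∈ voronoiCell P q) :
    radialProj hP p x = x := by
  have h1 : radialFactor hP p x = 1 := by
    refine le_antisymm (radialFactor_le_one hP hxp) ?_
    have hn : 0 < ‖q - p‖ ^ 2 := pow_pos (norm_pos_iff.2 (sub_ne_zero.2 hpq.symm)) 2
    have hd := dist_sq_sub_dist_sq x p q
    rw [dist_eq_of_mem_voronoiCell hp hq hxp hxq] at hd
    refine le_trans ?_ (Finset.le_sup' (fun q => 2 * ⟪x - p, q - p⟫ / ‖q - p‖ ^ 2) hq)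
    rw [le_div_iff₀ hn]
    linarith
  rw [radialProj, h1, inv_one, one_smul, add_sub_cancel]

theorem radialProj_mem_voronoiCell (hP : P.Nonempty) {p x : Plane}
    (hpos : 0 < radialFactor hP p x) : radialProj hP p x ∈ voronoiCell P p := by
  intro q hq
  rw [dist_le_dist_iff_inner, radialProj, add_sub_cancel_left, real_inner_smul_left]
  by_cases hqp : q = p
  · simp [hqp]
  · have hn : 0 < ‖q - p‖ ^ 2 := pow_pos (norm_pos_iff.2 (sub_ne_zero.2 hqp)) 2
    have h1 := Finset.le_sup' (fun q => 2 * ⟪x - p, q - p⟫ / ‖q - p‖ ^ 2) hq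
    change _ ≤ radialFactor hP p x at h1
    rw [div_le_iff₀ hn] at h1
    calc 2 * ((radialFactor hP p x)⁻¹ * ⟪x - p, q - p⟫)
        = (radialFactor hP p x)⁻¹ * (2 * ⟪x - p, q - p⟫) := by ring
      _ ≤ (radialFactor hP p x)⁻¹ * (radialFactor hP p x * ‖q - p‖ ^ 2) := by gcongr
      _ = ‖q - p‖ ^ 2 := by rw [← mul_assoc, inv_mul_cancel₀ hpos.ne', one_mul]

theorem radialProj_mem_multiCells (hP : P.Nonempty) {p x : Plane} (hp : p ∈ P)
    (hpos : 0 < radialFactor hP p x) : radialProj hP p x ∈ multiCells P := by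
  have hcell := radialProj_mem_voronoiCell hP hpos
  obtain ⟨q, hq, hmax⟩ :=
    Finset.exists_mem_eq_sup' hP fun q => 2 * ⟪x - p, q - p⟫ / ‖q - p‖ ^ 2
  change radialFactor hP p x = _ at hmax
  -- The term for `q = p` is `0 / 0 = 0`, so it cannot attain a positive maximum.
  have hqp : q ≠ p := by
    rintro rfl
    rw [hmax] at hpos
    simp at hpos
  have hn : 0 < ‖q - p‖ ^ 2 := pow_pos (norm_pos_iff.2 (sub_ne_zero.2 hqp)) 2
  refine ⟨p, hp, q, hq, hqp.symm, hcell, fun z hz => le_trans ?_ (hcell z hz)⟩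
  have hd := dist_sq_sub_dist_sq (radialProj hP p x) p q
  have hz : 2 * ⟪radialProj hP p x - p, q - p⟫ = ‖q - p‖ ^ 2 := by
    rw [eq_div_iff hn.ne'] at hmax
    rw [radialProj, add_sub_cancel_left, real_inner_smul_left, mul_left_comm, ← hmax,
      ← mul_assoc, inv_mul_cancel₀ hpos.ne', one_mul]
  refine (sq_le_sq₀ dist_nonneg dist_nonneg).1 ?_
  linarith

/-- Moving `x` directly away from `p` raises the distance to `p` by the full length of the move, and
the distance to any `y` by at most that length. -/
theorem radialProj_mem_domRegion (hP : P.Nonempty) {S : Set Plane} {p x : Plane} (hp : p ∈ P)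
    (hx : x ∈ voronoiCell P p) (hxS : x ∈ domRegion P S) (hpos : 0 < radialFactor hP p x) :
    radialProj hP p x ∈ domRegion P S := by
  intro y hy q hq
  refine lt_of_lt_of_le ?_ (radialProj_mem_voronoiCell hP hpos q hq)
  have hm : 1 ≤ (radialFactor hP p x)⁻¹ := (one_le_inv₀ hpos).2 (radialFactor_le_one hP hx)
  have h1 : dist (radialProj hP p x) x = ((radialFactor hP p x)⁻¹ - 1) * dist x p := by
    have : radialProj hP p x - x = ((radialFactor hP p x)⁻¹ - 1) • (x - p) := by
      rw [radialProj]; module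
    rw [dist_eq_norm, this, norm_smul, Real.norm_eq_abs, abs_of_nonneg (by linarith), dist_eq_norm]
  have h2 : dist (radialProj hP p x) p = (radialFactor hP p x)⁻¹ * dist x p := by
    rw [radialProj, dist_eq_norm, add_sub_cancel_left, norm_smul, Real.norm_eq_abs,
      abs_of_nonneg (by linarith), dist_eq_norm]
  have h3 := dist_triangle (radialProj hP p x) x y
  have h4 := hxS y hy p hp
  linarith

/-- Any two points of a convex set of the form `domRegion P S` with two nearest sites are joined
by an arc of such points, when `S` meets the convex hull of the sites. -/
theorem arcJoined_multiCells {S : Set Plane} {y : Plane} (hyS : y ∈ S)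
    (hy : y ∈ convexHull ℝ (P : Set Plane)) {c c' : Plane}
    (hc : c ∈ multiCells P ∩ domRegion P S) (hc' : c' ∈ multiCells P ∩ domRegion P S) :
    ArcJoined (multiCells P ∩ domRegion P S) c c' := by
  have hP : P.Nonempty := by
    obtain ⟨p, hp, -⟩ := hc.1
    exact ⟨p, hp⟩
  choose near hnear hcell using exists_mem_voronoiCell hP
  set T := multiCells P ∩ domRegion P S
  set g : Plane → Plane := fun x => radialProj hP (near x) x with hg
  have hseg : segment ℝ c c' ⊆ domRegion P S := (convex_domRegion P S).segment_subset hc.2 hc'.2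
  have hpos : ∀ p ∈ P, ∀ x ∈ domRegion P S, 0 < radialFactor hP p x := fun p hp x hx =>
    radialFactor_pos hP hy (hx y hyS p hp)
  have hgT : ∀ x ∈ domRegion P S, g x ∈ T := fun x hx =>
    ⟨radialProj_mem_multiCells hP (hnear x) (hpos _ (hnear x) x hx),
      radialProj_mem_domRegion hP (hnear x) (hcell x) hx (hpos _ (hnear x) x hx)⟩
  -- The choice of nearest site is immaterial: where two cells meet, both projections are the
  -- identity. Hence `g` is glued from continuous pieces on finitely many closed sets.
  have hgcell : ∀ p ∈ P, ∀ x ∈ voronoiCell P p, g x = radialProj hP p x := by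
    intro p hp x hx
    by_cases h : near x = p
    · rw [hg, ← h]
    · rw [hg, radialProj_eq_self hP hp (hnear x) (Ne.symm h) hx (hcell x)]
      exact radialProj_eq_self hP (hnear x) hp h (hcell x) hx
  have hgfix : ∀ x ∈ multiCells P, g x = x := by
    rintro x ⟨p, hp, q, hq, hpq, hxp, hxq⟩
    rw [hgcell p hp x hxp]
    exact radialProj_eq_self hP hp hq hpq hxp hxq
  have hcont : ContinuousOn g (segment ℝ c c') := by
    have hcover : segment ℝ c c' = ⋃ p : P, voronoiCell P p ∩ segment ℝ c c' := by
      ext x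
      simp only [Set.mem_iUnion, Set.mem_inter_iff]
      exact ⟨fun hx => ⟨⟨near x, hnear x⟩, hcell x, hx⟩, fun ⟨_, _, hx⟩ => hx⟩
    rw [hcover]
    have hsegc : IsClosed (segment ℝ c c') := by
      rw [segment_eq_image_lineMap]
      exact (isCompact_Icc.image AffineMap.lineMap_continuous).isClosed
    refine (locallyFinite_of_finite _).continuousOn_iUnion
      (fun p => (isClosed_voronoiCell P p).inter hsegc) fun p => ?_
    refine ContinuousOn.congr (f := radialProj hP p) ?_ fun x hx => hgcell p p.2 x hx.1
    refine continuousOn_const.add (ContinuousOn.smul (ContinuousOn.inv₀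
      (continuous_radialFactor hP p).continuousOn fun x hx => ?_) (by fun_prop))
    exact (hpos p p.2 x (hseg hx.2)).ne'
  have key := (convex_segment c c').isPreconnected.induction₂
    (fun a b => ArcJoined T (g a) (g b)) (fun x hx => ?_)
    (fun _ _ _ _ _ _ h h' => h.trans h') (fun _ _ _ _ h => h.symm)
    (left_mem_segment ℝ c c') (right_mem_segment ℝ c c')
  · rwa [hgfix c hc.1, hgfix c' hc'.1] at key
  -- For `z` near `x`, the two nearest sites of `g z` are also nearest to `g x`, so the segment
  -- between these images stays in both convex cells.
  · filter_upwards [(hcont x hx).eventually (eventually_mem_voronoiCell P (g x)),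
      self_mem_nhdsWithin] with z hz hzseg
    have hzT := hgT z (hseg hzseg)
    obtain ⟨p, hp, q, hq, hpq, hzp, hzq⟩ := hzT.1
    refine ArcJoined.of_segment_subset fun v hv => ⟨⟨p, hp, q, hq, hpq, ?_, ?_⟩, ?_⟩
    · exact (convex_voronoiCell P p).segment_subset (hz p hp hzp) hzp hv
    · exact (convex_voronoiCell P q).segment_subset (hz q hq hzq) hzq hv
    · exact (convex_domRegion P S).segment_subset (hgT x (hseg hx)).2 hzT.2 hv

end Retraction

/-! ### Angles and sectors in the plane. -/

section PlaneGeometry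

theorem Plane.inner_eq (v w : Plane) : ⟪v, w⟫ = v 0 * w 0 + v 1 * w 1 := by
  simp [PiLp.inner_apply, Fin.sum_univ_two, mul_comm]

theorem Plane.norm_sq_eq (v : Plane) : ‖v‖ ^ 2 = v 0 ^ 2 + v 1 ^ 2 := by
  simp [EuclideanSpace.norm_sq_eq, Fin.sum_univ_two]

theorem Plane.sq_add_sq_pos {w : Plane} (hw : w ≠ 0) : 0 < w 0 ^ 2 + w 1 ^ 2 := by
  rw [← Plane.norm_sq_eq]
  exact pow_pos (norm_pos_iff.2 hw) 2

theorem Plane.exists_smul_of_inner_eq_zero {a b w : Plane} (hw : w ≠ 0) (hb : b ≠ 0)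
    (haw : ⟪a, w⟫ = 0) (hbw : ⟪b, w⟫ = 0) : ∃ t : ℝ, a = t • b := by
  rw [Plane.inner_eq] at haw hbw
  have hw2 := Plane.sq_add_sq_pos hw
  have hb2 := Plane.sq_add_sq_pos hb
  have hdet : a 0 * b 1 = a 1 * b 0 := by
    have h : (a 0 * b 1 - a 1 * b 0) * (w 0 ^ 2 + w 1 ^ 2) = 0 := by
      linear_combination (w 0 * b 1 - b 0 * w 1) * haw + (a 0 * w 1 - a 1 * w 0) * hbw
    rcases mul_eq_zero.1 h with h | h
    · linarith
    · exact absurd h hw2.ne'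
  refine ⟨(a 0 * b 0 + a 1 * b 1) / (b 0 ^ 2 + b 1 ^ 2), ?_⟩
  ext i
  fin_cases i
  · simp only [Fin.zero_eta, PiLp.smul_apply, smul_eq_mul]
    field_simp
    linear_combination (b 1) * hdet
  · simp only [Fin.mk_one, PiLp.smul_apply, smul_eq_mul]
    field_simp
    linear_combination (-b 0) * hdet

/-- The vectors making the same angle with `w` as two distinct vectors `n`, `m` of equal length
form the two rays spanned by `n` and `m`. -/
theorem Plane.exists_pos_smul_of_angle_eq {n m v w : Plane} (hw : w ≠ 0) (hv : v ≠ 0)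
    (hnm : n ≠ m) (hnorm : ‖n‖ = ‖m‖) (hin : ⟪n, w⟫ = ⟪m, w⟫)
    (hang : ‖n‖ * ⟪v, w⟫ = ⟪n, w⟫ * ‖v‖) : ∃ s > (0 : ℝ), v = s • n ∨ v = s • m := by
  have hn : 0 < ‖n‖ := by
    refine lt_of_le_of_ne (norm_nonneg n) fun h => hnm ?_
    exact (norm_eq_zero.1 h.symm).trans (norm_eq_zero.1 (hnorm ▸ h.symm)).symm
  have hv' : 0 < ‖v‖ := norm_pos_iff.2 hv
  set v' : Plane := (‖n‖ / ‖v‖) • v with hv'def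
  have hvv' : v = (‖v‖ / ‖n‖) • v' := by
    rw [hv'def, smul_smul, div_mul_div_cancel₀ hn.ne', div_self hv'.ne', one_smul]
  have hnv' : ‖v'‖ = ‖n‖ := by
    rw [hv'def, norm_smul, Real.norm_eq_abs, abs_of_pos (by positivity), div_mul_cancel₀ _ hv'.ne']
  have hinv' : ⟪v', w⟫ = ⟪n, w⟫ := by
    rw [hv'def, real_inner_smul_left, div_mul_eq_mul_div, hang, mul_div_assoc, div_self hv'.ne',
      mul_one]
  -- The rescaled `v'` lies on the line through `n` and `m`, perpendicular to `w`, and on their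
  -- common circle about the origin. The two intersection points are `t = 0` and `t = -1`.
  obtain ⟨t, ht⟩ := Plane.exists_smul_of_inner_eq_zero (a := v' - n) (b := n - m) hw
    (sub_ne_zero.2 hnm) (by rw [inner_sub_left, hinv', sub_self])
    (by rw [inner_sub_left, hin, sub_self])
  have hD : 0 < ‖n - m‖ ^ 2 := pow_pos (norm_pos_iff.2 (sub_ne_zero.2 hnm)) 2
  have h1 : ‖n - m‖ ^ 2 = 2 * ⟪n, n - m⟫ := by
    rw [norm_sub_sq_real, inner_sub_right, real_inner_self_eq_norm_sq, ← hnorm]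
    ring
  have h2 : ‖v'‖ ^ 2 = ‖n‖ ^ 2 + 2 * (t * ⟪n, n - m⟫) + t ^ 2 * ‖n - m‖ ^ 2 := by
    have : v' = n + t • (n - m) := by rw [← ht]; abel
    rw [this, norm_add_sq_real, real_inner_smul_right, norm_smul, mul_pow, Real.norm_eq_abs, sq_abs]
  have h3 : (t * (t + 1)) * ‖n - m‖ ^ 2 = 0 := by
    rw [hnv'] at h2
    linear_combination t * h1 - h2
  refine ⟨‖v‖ / ‖n‖, by positivity, ?_⟩
  rcases mul_eq_zero.1 ((mul_eq_zero.1 h3).resolve_right hD.ne') with h | h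
  · left
    rw [h, zero_smul, sub_eq_zero] at ht
    rwa [ht] at hvv'
  · right
    have ht' : t = -1 := by linarith
    have : v' = m := by
      rw [ht', neg_one_smul, neg_sub] at ht
      simpa using ht
    rwa [this] at hvv'

/-- Put `a = cos θ`, `h = R cos α`, `h' = R cos α'` with angles in `[0, π]`. The hypotheses become
`α' ≤ |α - θ|`, `α ≤ |α' - θ|` and `θ < α`, which leave only `θ = 0`. -/
theorem eq_one_of_sector {a b h k h' k' R : ℝ} (hR : 0 < R) (hab : a ^ 2 + b ^ 2 = 1)
    (hhk : h ^ 2 + k ^ 2 = R ^ 2) (hhk' : h' ^ 2 + k' ^ 2 = R ^ 2) (hb : 0 ≤ b) (hk : 0 ≤ k)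
    (hk' : 0 ≤ k') (h₁ : a * h + b * k ≤ h') (h₂ : a * h' + b * k' ≤ h) (h₃ : h < R * a) :
    a = 1 := by
  have polar : ∀ x y : ℝ, x ^ 2 + y ^ 2 = R ^ 2 → 0 ≤ y →
      ∃ α ∈ Set.Icc 0 Real.pi, x = R * Real.cos α ∧ y = R * Real.sin α := by
    intro x y hxy hy
    have hx : |x| ≤ R := abs_le_of_sq_le_sq (by nlinarith) hR.le
    obtain ⟨hx1, hx2⟩ := abs_le.1 hx
    refine ⟨Real.arccos (x / R), ⟨Real.arccos_nonneg _, Real.arccos_le_pi _⟩, ?_, ?_⟩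
    · rw [Real.cos_arccos (by rw [le_div_iff₀ hR]; linarith) (by rw [div_le_iff₀ hR]; linarith),
        mul_div_cancel₀ _ hR.ne']
    · rw [Real.sin_arccos]
      have : 1 - (x / R) ^ 2 = (y / R) ^ 2 := by
        field_simp
        linarith
      rw [this, Real.sqrt_sq (by positivity), mul_div_cancel₀ _ hR.ne']
  obtain ⟨θ, hθ, hxa, hyb⟩ := polar (R * a) (R * b) (by linear_combination R ^ 2 * hab)
    (by positivity)
  obtain ⟨α, hα, rfl, rfl⟩ := polar h k hhk hk
  obtain ⟨α', hα', rfl, rfl⟩ := polar h' k' hhk' hk'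
  have ha := mul_left_cancel₀ hR.ne' hxa
  have hb' := mul_left_cancel₀ hR.ne' hyb
  subst ha hb'
  have c₁ : Real.cos (α - θ) ≤ Real.cos α' := by
    rw [Real.cos_sub]
    refine le_of_mul_le_mul_left ?_ hR
    linarith
  have c₂ : Real.cos (α' - θ) ≤ Real.cos α := by
    rw [Real.cos_sub]
    refine le_of_mul_le_mul_left ?_ hR
    linarith
  have c₃ : θ < α := (Real.strictAntiOn_cos.lt_iff_gt hα hθ).1 (lt_of_mul_lt_mul_left h₃ hR.le)
  have d₁ : α' ≤ α - θ := (Real.strictAntiOn_cos.le_iff_ge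
    ⟨by linarith, by linarith [hα.2, hθ.1]⟩ hα').1 c₁
  have d₂ : θ = 0 := by
    rcases le_total θ α' with hle | hle
    · have := (Real.strictAntiOn_cos.le_iff_ge
        ⟨by linarith, by linarith [hα'.2, hθ.1]⟩ hα).1 c₂
      linarith [hθ.1]
    · rw [← Real.cos_neg, neg_sub] at c₂
      have := (Real.strictAntiOn_cos.le_iff_ge
        ⟨by linarith, by linarith [hα'.1, hθ.2]⟩ hα).1 c₂
      linarith [hα'.1]
  rw [d₂, Real.cos_zero]

/-- The vectors `n`, `m` are mirror images in the axis `w`, and `n'`, `m'` in the axis `w'`. Hence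
the larger of `⟪n, w'⟫` and `⟪m, w'⟫` is the sum with both sine terms in absolute value, and
symmetrically for the other pair, which reduces the claim to `eq_one_of_sector`. -/
theorem Plane.eq_of_sector {n m n' m' w w' : Plane} (hw : ‖w‖ = 1) (hw' : ‖w'‖ = 1)
    (hnm : n ≠ m) (hm : ‖m‖ = ‖n‖) (hn' : ‖n'‖ = ‖n‖) (hm' : ‖m'‖ = ‖n‖)
    (hin : ⟪m, w⟫ = ⟪n, w⟫) (hin' : ⟪m', w'⟫ = ⟪n', w'⟫) (hnm' : n' ≠ m')
    (h₁ : ⟪n, w'⟫ ≤ ⟪n', w'⟫) (h₂ : ⟪m, w'⟫ ≤ ⟪n', w'⟫)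
    (h₃ : ⟪n', w⟫ ≤ ⟪n, w⟫) (h₄ : ⟪m', w⟫ ≤ ⟪n, w⟫) (hlt : ⟪n, w⟫ < ‖n‖ * ⟪w', w⟫) : w' = w := by
  have hn : 0 < ‖n‖ := by
    refine lt_of_le_of_ne (norm_nonneg n) fun h => hnm ?_
    exact (norm_eq_zero.1 h.symm).trans (norm_eq_zero.1 (hm.trans h.symm)).symm
  have frame : ∀ (u x y : Plane), ‖u‖ = 1 → ‖y‖ = ‖x‖ → ⟪y, u⟫ = ⟪x, u⟫ → x ≠ y →
      ∀ v : Plane, ⟪x, v⟫ = ⟪u, v⟫ * ⟪x, u⟫ + (u 0 * v 1 - u 1 * v 0) * (u 0 * x 1 - u 1 * x 0) ∧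
      ⟪y, v⟫ = ⟪u, v⟫ * ⟪x, u⟫ - (u 0 * v 1 - u 1 * v 0) * (u 0 * x 1 - u 1 * x 0) ∧
      ⟪x, u⟫ ^ 2 + |u 0 * x 1 - u 1 * x 0| ^ 2 = ‖x‖ ^ 2 := by
    intro u x y hu hyx hin hxy v
    have hu2 : u 0 ^ 2 + u 1 ^ 2 = 1 := by rw [← Plane.norm_sq_eq, hu, one_pow]
    have hyx2 : y 0 ^ 2 + y 1 ^ 2 = x 0 ^ 2 + x 1 ^ 2 := by
      rw [← Plane.norm_sq_eq, ← Plane.norm_sq_eq, hyx]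
    rw [sq_abs]
    simp only [Plane.inner_eq, Plane.norm_sq_eq] at *
    have e : ∀ z : Plane, z 0 = (z 0 * u 0 + z 1 * u 1) * u 0 - (u 0 * z 1 - u 1 * z 0) * u 1 ∧
        z 1 = (z 0 * u 0 + z 1 * u 1) * u 1 + (u 0 * z 1 - u 1 * z 0) * u 0 := fun z =>
      ⟨by linear_combination (-z 0) * hu2, by linear_combination (-z 1) * hu2⟩
    have hk : u 0 * y 1 - u 1 * y 0 = -(u 0 * x 1 - u 1 * x 0) := by
      have hsq : (u 0 * y 1 - u 1 * y 0) ^ 2 = (u 0 * x 1 - u 1 * x 0) ^ 2 := by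
        linear_combination (u 0 ^ 2 + u 1 ^ 2) * hyx2 -
          (y 0 * u 0 + y 1 * u 1 + (x 0 * u 0 + x 1 * u 1)) * hin
      rcases sq_eq_sq_iff_eq_or_eq_neg.1 hsq with h | h
      · refine absurd ?_ hxy
        ext i
        fin_cases i
        · change x 0 = y 0
          rw [(e x).1, (e y).1, hin, h]
        · change x 1 = y 1
          rw [(e x).2, (e y).2, hin, h]
      · exact h
    refine ⟨?_, ?_, ?_⟩
    · linear_combination (-(x 0 * v 0 + x 1 * v 1)) * hu2
    · linear_combination (-(y 0 * v 0 + y 1 * v 1)) * hu2 +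
        (u 0 * v 0 + u 1 * v 1) * hin + (u 0 * v 1 - u 1 * v 0) * hk
    · linear_combination (x 0 ^ 2 + x 1 ^ 2) * hu2
  obtain ⟨f₁, f₂, f₃⟩ := frame w n m hw hm hin hnm w'
  obtain ⟨g₁, g₂, g₃⟩ := frame w' n' m' hw' (hm'.trans hn'.symm) hin' hnm' w
  rw [hn'] at g₃
  have hsq : ⟪w', w⟫ ^ 2 + |w 0 * w' 1 - w 1 * w' 0| ^ 2 = 1 := by
    have e := Plane.norm_sq_eq w
    have e' := Plane.norm_sq_eq w'
    rw [hw, one_pow] at e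
    rw [hw', one_pow] at e'
    rw [sq_abs, Plane.inner_eq]
    linear_combination (-(w' 0 ^ 2 + w' 1 ^ 2)) * e - e'
  have hone : ⟪w', w⟫ = 1 := by
    refine eq_one_of_sector hn hsq f₃ g₃ (abs_nonneg _) (abs_nonneg _) (abs_nonneg _) ?_ ?_ hlt
    · rw [← abs_mul, real_inner_comm w w']
      rcases abs_cases ((w 0 * w' 1 - w 1 * w' 0) * (w 0 * n 1 - w 1 * n 0)) with h | h <;>
        linarith [h.1]
    · rw [abs_sub_comm (w 0 * w' 1), ← abs_mul]
      have e : w 1 * w' 0 - w 0 * w' 1 = w' 0 * w 1 - w' 1 * w 0 := by ring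
      rw [e]
      rcases abs_cases ((w' 0 * w 1 - w' 1 * w 0) * (w' 0 * n' 1 - w' 1 * n' 0)) with h | h <;>
        linarith [h.1]
  exact (inner_eq_one_iff_of_norm_eq_one hw' hw).1 hone

theorem Plane.exists_pos_smul_of_sector {n m n' m' w w' : Plane} (hw : w ≠ 0) (hw' : w' ≠ 0)
    (hnm : n ≠ m) (hm : ‖m‖ = ‖n‖) (hn' : ‖n'‖ = ‖n‖) (hm' : ‖m'‖ = ‖n‖)
    (hin : ⟪m, w⟫ = ⟪n, w⟫) (hin' : ⟪m', w'⟫ = ⟪n', w'⟫) (hnm' : n' ≠ m')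
    (h₁ : ⟪n, w'⟫ ≤ ⟪n', w'⟫) (h₂ : ⟪m, w'⟫ ≤ ⟪n', w'⟫)
    (h₃ : ⟪n', w⟫ ≤ ⟪n, w⟫) (h₄ : ⟪m', w⟫ ≤ ⟪n, w⟫)
    (hlt : ⟪n, w⟫ * ‖w'‖ < ‖n‖ * ⟪w', w⟫) : ∃ s > (0 : ℝ), w' = s • w := by
  have hW : 0 < ‖w‖ := norm_pos_iff.2 hw
  have hW' : 0 < ‖w'‖ := norm_pos_iff.2 hw'
  have key : ‖w'‖⁻¹ • w' = ‖w‖⁻¹ • w := by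
    refine Plane.eq_of_sector (norm_smul_inv_norm hw) (norm_smul_inv_norm hw') hnm hm hn' hm'
      ?_ ?_ hnm' ?_ ?_ ?_ ?_ ?_ <;> simp only [real_inner_smul_right, real_inner_smul_left]
    · rw [hin]
    · rw [hin']
    · gcongr
    · gcongr
    · gcongr
    · gcongr
    · calc ‖w‖⁻¹ * ⟪n, w⟫ = ‖w‖⁻¹ * ‖w'‖⁻¹ * (⟪n, w⟫ * ‖w'‖) := by field_simp
        _ < ‖w‖⁻¹ * ‖w'‖⁻¹ * (‖n‖ * ⟪w', w⟫) := by gcongr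
        _ = _ := by ring
  refine ⟨‖w'‖ * ‖w‖⁻¹, by positivity, ?_⟩
  rw [mul_smul, ← key, smul_smul, mul_inv_cancel₀ hW'.ne', one_smul]

end PlaneGeometry

/-! ### Uniqueness: separating branches by sectors. -/

section Uniqueness

variable {P : Finset Plane} {S : Set Plane}

/-- A point on the ray from `x` through a nearest site `p` either has `p` as its only nearest site
or lies beyond `p`, outside the convex set `domRegion P S`. -/
theorem notMem_of_mem_ray (hS : S.Nonempty) {x p : Plane} (hp : p ∈ P)
    (hxp : x ∈ voronoiCell P p) (hxS : x ∈ domRegion P S) {s : ℝ} (hs : 0 < s) :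
    x + s • (p - x) ∉ multiCells P ∩ domRegion P S := by
  rintro ⟨hT, hzS⟩
  -- Beyond `p`, convexity would put the site `p` itself into `domRegion P S`. Before `p`, every
  -- other site is strictly farther than `p`.
  rcases le_or_gt 1 s with h1 | h1
  · refine notMem_domRegion hS hp ((convex_domRegion P S).segment_subset hxS hzS ?_)
    refine ⟨1 - s⁻¹, s⁻¹, by linarith [inv_le_one_of_one_le₀ h1], by positivity, by ring, ?_⟩
    rw [smul_add, smul_smul, inv_mul_cancel₀ hs.ne']
    module
  · obtain ⟨q, hq, hqp, hzq⟩ : ∃ q ∈ P, q ≠ p ∧ x + s • (p - x) ∈ voronoiCell P q := by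
      obtain ⟨q, hq, q', hq', hne, hzq, hzq'⟩ := hT
      by_cases h : q = p
      · exact ⟨q', hq', fun h' => hne (h.trans h'.symm), hzq'⟩
      · exact ⟨q, hq, h, hzq⟩
    have h2 := hzq p hp
    rw [dist_le_dist_iff_inner] at h2
    have h3 := dist_sq_sub_dist_sq x q p
    have h4 : dist x p ^ 2 ≤ dist x q ^ 2 := by
      have := hxp q hq
      gcongr
    have e : x + s • (p - x) - q = (1 - s) • (x - q) + s • (p - q) := by module
    rw [e, inner_add_left, real_inner_smul_left, real_inner_smul_left,
      real_inner_self_eq_norm_sq] at h2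
    have hn : 0 < ‖p - q‖ ^ 2 := pow_pos (norm_pos_iff.2 (sub_ne_zero.2 hqp.symm)) 2
    nlinarith

/-- For a point `z` near `x` there is a continuous function that is positive at `z`, vanishes at
no other point than `x`, and whose positivity characterises the ray from `x` to `z` near `x`. -/
theorem exists_sector_function (hS : S.Nonempty) {x : Plane} (hxS : x ∈ domRegion P S) :
    ∃ ε > 0, ∀ z ∈ (multiCells P ∩ domRegion P S) ∩ Metric.ball x ε, z ≠ x →
      ∃ F : Plane → ℝ, Continuous F ∧ 0 < F z ∧
        (∀ y ∈ multiCells P ∩ domRegion P S, F y = 0 → y = x) ∧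
        ∀ y ∈ (multiCells P ∩ domRegion P S) ∩ Metric.ball x ε, y ≠ x → 0 < F y →
          ∃ s > (0 : ℝ), y - x = s • (z - x) := by
  obtain ⟨ε, hε, hball⟩ := Metric.eventually_nhds_iff_ball.1 (eventually_mem_voronoiCell P x)
  -- To first order, the sites nearest to `z` are those nearest sites of `x` lying most in the
  -- direction `z - x`.
  have hinner : ∀ z ∈ Metric.ball x ε, ∀ p ∈ P, ∀ q ∈ P, z ∈ voronoiCell P p →
      x ∈ voronoiCell P q → ⟪q - x, z - x⟫ ≤ ⟪p - x, z - x⟫ := by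
    intro z hz p hp q hq hzp hxq
    have h1 := hzp q hq
    rw [dist_le_dist_iff_inner] at h1
    have h2 := dist_sq_sub_dist_sq x p q
    rw [dist_eq_of_mem_voronoiCell hp hq (hball z hz p hp hzp) hxq, sub_self] at h2
    have e : ⟪z - p, q - p⟫ = ⟪x - p, q - p⟫ + (⟪q - x, z - x⟫ - ⟪p - x, z - x⟫) := by
      have e1 : z - p = (x - p) + (z - x) := by abel
      have e2 : q - p = (q - x) - (p - x) := by abel
      rw [e1, inner_add_left, ← inner_sub_left, ← e2, real_inner_comm (q - p) (z - x)]
    linarith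
  have hnorm : ∀ p ∈ P, ∀ q ∈ P, x ∈ voronoiCell P p → x ∈ voronoiCell P q →
      ‖p - x‖ = ‖q - x‖ := by
    intro p hp q hq h1 h2
    rw [← dist_eq_norm, ← dist_eq_norm, dist_comm p, dist_comm q]
    exact dist_eq_of_mem_voronoiCell hp hq h1 h2
  refine ⟨ε, hε, ?_⟩
  rintro z ⟨⟨⟨p, hp, q, hq, hpq, hzp, hzq⟩, -⟩, hz⟩ hzx
  have hxp := hball z hz p hp hzp
  have hxq := hball z hz q hq hzq
  have hw : z - x ≠ 0 := sub_ne_zero.2 hzx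
  have hpq' : p - x ≠ q - x := fun h => hpq (sub_left_injective h)
  have hin : ⟪p - x, z - x⟫ = ⟪q - x, z - x⟫ :=
    le_antisymm (hinner z hz q hq p hp hzq hxp) (hinner z hz p hp q hq hzp hxq)
  have hpqn := hnorm p hp q hq hxp hxq
  -- The sign compares the angle of `y - x` against `z - x` with that of `p - x`. The zero set is
  -- `x` with the two rays towards `p` and `q`, and those rays miss `T`.
  refine ⟨fun y => ‖p - x‖ * ⟪y - x, z - x⟫ - ⟪p - x, z - x⟫ * ‖y - x‖, by fun_prop, ?_, ?_, ?_⟩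
  · have h1 := inner_lt_of_two_points hpq' hpqn hw hin
    have h2 : 0 < ‖z - x‖ := norm_pos_iff.2 hw
    simp only [real_inner_self_eq_norm_sq]
    nlinarith
  · intro y hy hFy
    by_contra hyx
    obtain ⟨s, hs, h | h⟩ := Plane.exists_pos_smul_of_angle_eq hw (sub_ne_zero.2 hyx) hpq' hpqn hin
      (sub_eq_zero.1 hFy)
    · refine notMem_of_mem_ray hS hp hxp hxS hs ?_
      rwa [← h, add_sub_cancel]
    · refine notMem_of_mem_ray hS hq hxq hxS hs ?_
      rwa [← h, add_sub_cancel]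
  · rintro y ⟨⟨⟨p', hp', q', hq', hpq₂, hyp, hyq⟩, -⟩, hy⟩ hyx hFy
    have hxp' := hball y hy p' hp' hyp
    have hxq' := hball y hy q' hq' hyq
    refine Plane.exists_pos_smul_of_sector (n' := p' - x) (m' := q' - x) hw (sub_ne_zero.2 hyx) hpq'
      hpqn.symm (hnorm p' hp' p hp hxp' hxp) (hnorm q' hq' p hp hxq' hxp) hin.symm ?_
      (fun h => hpq₂ (sub_left_injective h)) ?_ ?_ ?_ ?_ (sub_pos.1 hFy)
    · exact le_antisymm (hinner y hy p' hp' q' hq' hyp hxq') (hinner y hy q' hq' p' hp' hyq hxp')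
    · exact hinner y hy p' hp' p hp hyp hxp
    · exact hinner y hy p' hp' q hq hyp hxq
    · exact hinner z hz p hp p' hp' hzp hxp'
    · exact hinner z hz p hp q' hq' hzp hxq'

theorem IsPreconnected.pos_of_ne_zero {X : Type*} [TopologicalSpace X] {s : Set X}
    (hs : IsPreconnected s) {g : X → ℝ} (hg : ContinuousOn g s) (h0 : ∀ a ∈ s, g a ≠ 0)
    {a b : X} (ha : a ∈ s) (hb : b ∈ s) (hpos : 0 < g a) : 0 < g b := by
  by_contra! h
  obtain ⟨c, hc, hc0⟩ := hs.intermediate_value hb ha hg ⟨h, hpos.le⟩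
  exact h0 c hc hc0

/-- A connected set of points with two nearest sites that contains the end points of an arc of such
points contains the arc. -/
theorem mem_of_isPreconnected (hS : S.Nonempty) {f : ℝ → Plane} (hf : Continuous f)
    (hinj : Set.InjOn f (Set.Icc 0 1))
    (hmap : Set.MapsTo f (Set.Icc 0 1) (multiCells P ∩ domRegion P S)) {A : Set Plane}
    (hA : IsPreconnected A) (hAT : A ⊆ multiCells P ∩ domRegion P S) (h0 : f 0 ∈ A) (h1 : f 1 ∈ A)
    {t : ℝ} (ht : t ∈ Set.Ioo 0 1) : f t ∈ A := by
  have htI : t ∈ Set.Icc (0 : ℝ) 1 := ⟨ht.1.le, ht.2.le⟩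
  obtain ⟨ε, hε, hsec⟩ := exists_sector_function hS (hmap htI).2
  obtain ⟨δ, hδ, hball⟩ := Metric.continuousAt_iff.1 hf.continuousAt ε hε
  have hne : ∀ s ∈ Set.Icc (0 : ℝ) 1, s ≠ t → f s ≠ f t := fun s hs hst h => hst (hinj hs htI h)
  obtain ⟨t₁, ht₁, ht₁'⟩ : ∃ t₁, max 0 (t - δ) < t₁ ∧ t₁ < t :=
    exists_between (max_lt ht.1 (by linarith))
  obtain ⟨t₂, ht₂, ht₂'⟩ : ∃ t₂, t < t₂ ∧ t₂ < min 1 (t + δ) :=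
    exists_between (lt_min ht.2 (by linarith))
  obtain ⟨h10, h1δ⟩ := max_lt_iff.1 ht₁
  obtain ⟨h21, h2δ⟩ := lt_min_iff.1 ht₂'
  have hnear : ∀ s ∈ Set.Icc t₁ t₂, f s ∈ (multiCells P ∩ domRegion P S) ∩ Metric.ball (f t) ε := by
    intro s hs
    refine ⟨hmap ⟨by linarith [hs.1], by linarith [hs.2]⟩, hball ?_⟩
    rw [Real.dist_eq, abs_lt]
    constructor <;> linarith [hs.1, hs.2]
  obtain ⟨F, hF, hFz, hF0, hFray⟩ := hsec (f t₁) (hnear t₁ ⟨le_rfl, by linarith⟩)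
    (hne t₁ ⟨by linarith, by linarith⟩ ht₁'.ne)
  have hFne : ∀ s ∈ Set.Icc (0 : ℝ) 1, s ≠ t → F (f s) ≠ 0 := fun s hs hst h =>
    hne s hs hst (hF0 _ (hmap hs) h)
  have hleft : ∀ s ∈ Set.Ico 0 t, 0 < F (f s) := fun s hs =>
    isPreconnected_Ico.pos_of_ne_zero (g := F ∘ f) (hF.comp hf).continuousOn
      (fun a ha => hFne a ⟨ha.1, by linarith [ha.2]⟩ ha.2.ne) ⟨h10.le, ht₁'⟩ hs hFz
  -- If `F` were positive on both sides of `t`, the arc would arrive and leave along the same ray.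
  -- Both sides would then take a common distance `ρ` from `f t`, hence a common point, against
  -- injectivity.
  have hFt₂ : F (f t₂) < 0 := by
    refine lt_of_le_of_ne (not_lt.1 fun hpos => ?_)
      (hFne t₂ ⟨by linarith, by linarith⟩ ht₂.ne')
    have hright : ∀ s ∈ Set.Ioc t 1, 0 < F (f s) := fun s hs =>
      isPreconnected_Ioc.pos_of_ne_zero (g := F ∘ f) (hF.comp hf).continuousOn
        (fun a ha => hFne a ⟨by linarith [ha.1], ha.2⟩ ha.1.ne') ⟨ht₂, h21.le⟩ hs hpos
    have hray : ∀ s ∈ Set.Icc t₁ t₂, s ≠ t →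
        ∃ l > (0 : ℝ), f s - f t = l • (f t₁ - f t) := by
      intro s hs hst
      refine hFray _ (hnear s hs) (hne s ⟨by linarith [hs.1], by linarith [hs.2]⟩ hst) ?_
      rcases lt_or_gt_of_ne hst with h | h
      · exact hleft s ⟨by linarith [hs.1], h⟩
      · exact hright s ⟨h, by linarith [hs.2]⟩
    have hnpos : ∀ s ∈ Set.Icc (0 : ℝ) 1, s ≠ t → 0 < ‖f s - f t‖ := fun s hs hst =>
      norm_pos_iff.2 (sub_ne_zero.2 (hne s hs hst))
    set ρ := min ‖f t₁ - f t‖ ‖f t₂ - f t‖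
    have hρ : 0 < ρ := lt_min (hnpos t₁ ⟨by linarith, by linarith⟩ ht₁'.ne)
      (hnpos t₂ ⟨by linarith, by linarith⟩ ht₂.ne')
    have hcont : Continuous fun s => ‖f s - f t‖ := by fun_prop
    obtain ⟨τ₁, hτ₁, e₁⟩ := intermediate_value_Icc' ht₁'.le hcont.continuousOn
      (show ρ ∈ Set.Icc ‖f t - f t‖ ‖f t₁ - f t‖ from ⟨by simpa using hρ.le, min_le_left _ _⟩)
    obtain ⟨τ₂, hτ₂, e₂⟩ := intermediate_value_Icc ht₂.le hcont.continuousOn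
      (show ρ ∈ Set.Icc ‖f t - f t‖ ‖f t₂ - f t‖ from ⟨by simpa using hρ.le, min_le_right _ _⟩)
    have n₁ : τ₁ ≠ t := by
      rintro rfl
      simp at e₁
      exact hρ.ne e₁
    have n₂ : τ₂ ≠ t := by
      rintro rfl
      simp at e₂
      exact hρ.ne e₂
    obtain ⟨l₁, hl₁, r₁⟩ := hray τ₁ ⟨hτ₁.1, by linarith [hτ₁.2]⟩ n₁
    obtain ⟨l₂, hl₂, r₂⟩ := hray τ₂ ⟨by linarith [hτ₂.1], hτ₂.2⟩ n₂
    have hz := hnpos t₁ ⟨by linarith, by linarith⟩ ht₁'.ne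
    have hl : l₁ = l₂ := by
      simp only [r₁, norm_smul, Real.norm_eq_abs, abs_of_pos hl₁] at e₁
      simp only [r₂, norm_smul, Real.norm_eq_abs, abs_of_pos hl₂] at e₂
      exact mul_right_cancel₀ hz.ne' (e₁.trans e₂.symm)
    have hff : f τ₁ = f τ₂ := sub_left_injective (r₁.trans (hl ▸ r₂.symm))
    have hττ := hinj (x₁ := τ₁) ⟨by linarith [hτ₁.1], by linarith [hτ₁.2]⟩ (x₂ := τ₂)
      ⟨by linarith [hτ₂.1], by linarith [hτ₂.2]⟩ hff
    exact n₁ (le_antisymm hτ₁.2 (hττ ▸ hτ₂.1))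
  have hF1 : 0 < -F (f 1) :=
    isPreconnected_Ioc.pos_of_ne_zero (g := fun s => -F (f s)) (by fun_prop)
      (fun a ha => neg_ne_zero.2 (hFne a ⟨by linarith [ha.1], ha.2⟩ ha.1.ne')) ⟨ht₂, h21.le⟩
      ⟨ht.2, le_rfl⟩ (neg_pos.2 hFt₂)
  -- `F` changes sign on the connected set `A`, and its only possible zero there is `f t`.
  obtain ⟨y, hy, hFy⟩ := hA.intermediate_value h1 h0 hF.continuousOn
    (show (0 : ℝ) ∈ Set.Icc (F (f 1)) (F (f 0)) from
      ⟨by linarith, (hleft 0 ⟨le_rfl, ht.1⟩).le⟩)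
  rwa [← hF0 y (hAT hy) hFy]

/-- The trace of an arc of points with two nearest sites is contained in that of any other path of
such points with the same end points. -/
theorem range_subset_range_of_injective (hS : S.Nonempty) {c c' : Plane} {γ γ' : Path c c'}
    (hγ : Function.Injective γ) (hγT : Set.range γ ⊆ multiCells P ∩ domRegion P S)
    (hγT' : Set.range γ' ⊆ multiCells P ∩ domRegion P S) : Set.range γ ⊆ Set.range γ' := by
  have hext : ∀ t : unitInterval, γ.extend t = γ t := fun t => γ.extend_apply t.2
  rintro _ ⟨t, rfl⟩
  rcases eq_or_ne t 0 with rfl | ht0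
  · exact ⟨0, by simp⟩
  rcases eq_or_ne t 1 with rfl | ht1
  · exact ⟨1, by simp⟩
  rw [← hext]
  refine mem_of_isPreconnected hS γ.continuous_extend ?_ ?_
    (isPreconnected_range γ'.continuous) hγT' (by simp) (by simp)
    ⟨unitInterval.pos_iff_ne_zero.2 ht0, unitInterval.lt_one_iff_ne_one.2 ht1⟩
  · intro a ha b hb hab
    exact congrArg Subtype.val
      (@hγ ⟨a, ha⟩ ⟨b, hb⟩ (by rw [← hext, ← hext]; exact hab))
  · intro a ha
    exact hγT ⟨⟨a, ha⟩, (hext ⟨a, ha⟩).symm⟩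

end Uniqueness

/-! ### Arcs along Voronoi edges and the conclusion. -/

/-- An arc of points with two nearest sites runs along the Voronoi edges. -/
theorem range_subset_voronoiSkeleton {P : Finset Plane} {c c' : Plane} {γ : Path c c'}
    (hγ : Function.Injective γ) (h : Set.range γ ⊆ multiCells P) :
    Set.range γ ⊆ voronoiSkeleton P := by
  rintro _ ⟨t, rfl⟩
  have hev := γ.continuous.continuousAt.eventually (eventually_mem_voronoiCell P (γ t))
  -- Cells of two sites may meet in a single point, which is no edge. A nearby second point of the
  -- arc supplies a pair of sites whose cells share both points.
  obtain ⟨s, hs, hst⟩ := ((hev.filter_mono nhdsWithin_le_nhds).and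
    (self_mem_nhdsWithin (a := t) (s := {t}ᶜ))).exists
  obtain ⟨p, hp, q, hq, hpq, hsp, hsq⟩ := h ⟨s, rfl⟩
  refine ⟨_, ⟨p, hp, q, hq, hpq, rfl, γ t, ?_, γ s, ⟨hsp, hsq⟩, ?_⟩, ?_⟩
  · exact ⟨hs p hp hsp, hs q hq hsq⟩
  · exact fun e => hst (hγ e).symm
  · exact ⟨hs p hp hsp, hs q hq hsq⟩

theorem mainTheorem7 (P : Finset Plane) (c c' : Plane) (r r' : ℝ)
    (hC : IsMEC P c r) (hC' : IsMEC P c' r')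
    (hne : Metric.ball c r ≠ Metric.ball c' r')
    (hover : (Metric.ball c r ∩ Metric.ball c' r' ∩
      convexHull ℝ (P : Set Plane)).Nonempty) :
    ∃! A : Set Plane, IsVoronoiPath P c c' A ∧
      ∀ x ∈ A, ∀ s : ℝ, IsMEC P x s →
        Metric.ball c r ∩ Metric.ball c' r' ⊆ Metric.ball x s := by
  obtain ⟨y, hyS, hy⟩ := hover
  set S := Metric.ball c r ∩ Metric.ball c' r'
  have hS : S.Nonempty := ⟨y, hyS⟩
  have hP : P.Nonempty := by
    rw [← Finset.coe_nonempty]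
    exact convexHull_nonempty_iff.1 ⟨y, hy⟩
  have hMEC : ∀ x s, IsMEC P x s → S ⊆ Metric.ball x s → x ∈ multiCells P ∩ domRegion P S := by
    intro x s hx hsub
    obtain ⟨p, hp, q, hq, hpq, hxp, hxq, rfl⟩ := hx.exists_two_sites hP
    refine ⟨⟨p, hp, q, hq, hpq, hxp, hxq⟩, fun z hz w hw => lt_of_lt_of_le ?_ (hxp w hw)⟩
    rw [dist_comm]
    exact hsub hz
  have hcT := hMEC c r hC Set.inter_subset_left
  have hcT' := hMEC c' r' hC' Set.inter_subset_right
  -- Concentric discs are nested, so maximality would make the two MECs equal.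
  have hcc' : c ≠ c' := by
    rintro rfl
    rcases le_total r r' with h | h
    · exact hne (by rw [(hC.2 c r' hC'.1 (Metric.ball_subset_ball h)).2])
    · exact hne (by rw [(hC'.2 c r hC.1 (Metric.ball_subset_ball h)).2])
  obtain ⟨γ, hγ, hγT⟩ := (arcJoined_multiCells hyS hy hcT hcT').exists_path hcc'
  have hpath : ∀ A, (IsVoronoiPath P c c' A ∧ ∀ x ∈ A, ∀ s : ℝ, IsMEC P x s →
      S ⊆ Metric.ball x s) → A ⊆ multiCells P ∩ domRegion P S := by
    rintro A ⟨⟨-, -, -, hA⟩, hAS⟩ x hx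
    obtain ⟨p, hp, q, hq, hpq, hxp, hxq⟩ := voronoiSkeleton_subset_multiCells (hA hx)
    have := isMEC_of_two_sites hp hq hpq hxp hxq
    exact hMEC x _ this (hAS x hx _ this)
  refine ⟨Set.range γ, ⟨⟨γ, hγ, rfl, range_subset_voronoiSkeleton hγ fun x hx => (hγT hx).1⟩, ?_⟩, ?_⟩
  · intro x hx s hs z hz
    obtain ⟨p, hp, -, -, -, -, -, rfl⟩ := hs.exists_two_sites hP
    rw [Metric.mem_ball, dist_comm]
    exact (hγT hx).2 z hz p hp
  · intro A hA
    have hAT := hpath A hA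
    obtain ⟨⟨γ', hγ', rfl, -⟩, -⟩ := hA
    exact (range_subset_range_of_injective hS hγ' hAT hγT).antisymm
      (range_subset_range_of_injective hS hγ hγT hAT)
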